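/- Let $n$ be a positive integer or $n=\infty$ (countably infinite), let $\mathcal F_n$ be the unital free semigroup on $n$ generators, and let $\mathcal H_n=\ell^2(\mathcal F_n)$ with standard orthonormal basis $\{\xi_w\}_{w\in\mathcal F_n}$. For a generator $z_i$ let $L_i$ be the isometry of $\mathcal H_n$ with $L_i\xi_v=\xi_{z_iv}$ for all $v\in\mathcal F_n$, and let $\mathfrak L_n\subseteq\mathcal B(\mathcal H_n)$ be the closure in the weak operator topology of the unital algebra generated by the $L_i$. Let $H^\infty$ be the algebra of bounded holomorphic functions on the open unit disk with the supremum norm. Its weak* topology is the coarsest one for which $f\mapsto\lim_{r\to1^-}\int_{\mathbb T}f(r\zeta)g(\zeta)\,dm(\zeta)=\int_{\mathbb T}f^*g\,dm$ is continuous for every $g\in L^1(\mathbb T,m)$, where $m$ is normalized arc length and $f^*$ is the boundary function of $f$ (that is, the topology inherited from $L^\infty(\mathbb T)=L^1(\mathbb T)^*$). The weak* topology of $\mathcal B(\mathcal H_n)$ is the one it has as the dual of the trace class operators. Corollary 1.6: Every non-unitary contraction $L\in\mathfrak L_n$ (that is, $\|L\|\le 1$ and $L$ is not unitary) has an $H^\infty$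 functional calculus: there is a unital algebra homomorphism $\Phi:H^\infty\to\mathcal B(\mathcal H_n)$, $\Phi(f)=f(L)$, which maps the coordinate function $z\mapsto z$ to $L$, satisfies $\|f(L)\|\le\|f\|_\infty$ for all $f\in H^\infty$, and is continuous with respect to the weak* topologies of $H^\infty$ and $\mathcal B(\mathcal H_n)$. -/

import Mathlib

open scoped ENNReal InnerProductSpace Topology BoundedContinuousFunction

/-! ### The free semigroup algebra `𝔏ₙ`

The alphabet is a type `ι`; the number `n` of generators is its cardinality, and the unital free
semigroup on `n` generators is `FreeMonoid ι`. -/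

/-- The Hilbert space `ℓ²` over the free monoid on the alphabet `ι`. -/
abbrev FockSpace (ι : Type*) : Type _ := lp (fun _ : FreeMonoid ι => ℂ) 2

namespace FockSpace

/-- The standard basis vector `ξ_w`. -/
noncomputable def xi {ι : Type*} (w : FreeMonoid ι) : FockSpace ι :=
  open Classical in lp.single 2 w 1

theorem orthonormal_xi (ι : Type*) : Orthonormal ℂ (xi : FreeMonoid ι → FockSpace ι) := by
  classical
  rw [orthonormal_iff_ite]
  intro v w
  rw [xi, xi, lp.inner_single_left]
  by_cases h : v = w
  · subst h
    simp
  · simp [lp.single_apply, h]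

theorem orthonormal_xi_mul {ι : Type*} (w : FreeMonoid ι) :
    Orthonormal ℂ (fun v : FreeMonoid ι => (xi (w * v) : FockSpace ι)) :=
  (orthonormal_xi ι).comp (fun v => w * v) (fun _ _ h => mul_left_cancel h)

/-- The left regular representation: `L_w` is the isometry of the Hilbert space that maps
`ξ_v` to `ξ_{wv}` for every word `v`. -/
noncomputable def leftShift {ι : Type*} (w : FreeMonoid ι) : FockSpace ι →L[ℂ] FockSpace ι :=
  (orthonormal_xi_mul w).orthogonalFamily.linearIsometry.toContinuousLinearMap

theorem leftShift_xi {ι : Type*} (w v : FreeMonoid ι) :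
    leftShift w (xi v : FockSpace ι) = xi (w * v) := by
  classical
  have h := (orthonormal_xi_mul w).orthogonalFamily.linearIsometry_apply_single (i := v) (1 : ℂ)
  rw [LinearIsometry.toSpanSingleton_apply, one_smul] at h
  exact h

/-- The non-commutative analytic Toeplitz algebra `𝔏ₙ`: the closure, in the weak operator topology,
of the unital algebra generated by the isometries `L_i` attached to the letters `i`. -/
noncomputable def analyticToeplitzAlgebra (ι : Type*) :
    Subalgebra ℂ (FockSpace ι →L[ℂ] FockSpace ι) :=
  ((Algebra.adjoin ℂ (Set.range fun i : ι =>
    ContinuousLinearMapWOT.ofCLM (leftShift (FreeMonoid.of i)))).topologicalClosure).comap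
      (ContinuousLinearMapWOT.algEquiv (𝕜₁ := ℂ) (E := FockSpace ι) ℂ).symm.toAlgHom

end FockSpace

/-! ### The algebra `H^∞` and its weak* topology -/

/-- The open unit disk in `ℂ`. -/
abbrev OpenDisk : Type := Metric.ball (0 : ℂ) 1

/-- A function on the open unit disk, extended by `0` to the whole plane. -/
noncomputable def OpenDisk.extend (f : OpenDisk → ℂ) : ℂ → ℂ := Function.extend Subtype.val f 0

theorem OpenDisk.extend_apply (f : OpenDisk → ℂ) {z : ℂ} (hz : z ∈ Metric.ball (0 : ℂ) 1) :
    OpenDisk.extend f z = f ⟨z, hz⟩ :=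
  Subtype.val_injective.extend_apply f 0 ⟨z, hz⟩

/-- `H^∞`: the bounded holomorphic functions on the open unit disk, with pointwise operations and
the supremum norm. -/
noncomputable def HInfty : Subalgebra ℂ (OpenDisk →ᵇ ℂ) where
  carrier := {f | DifferentiableOn ℂ (OpenDisk.extend f) (Metric.ball 0 1)}
  mul_mem' {f g} hf hg := (DifferentiableOn.mul hf hg).congr fun z hz => by
    simp [OpenDisk.extend_apply _ hz]
  add_mem' {f g} hf hg := (DifferentiableOn.add hf hg).congr fun z hz => by
    simp [OpenDisk.extend_apply _ hz]
  algebraMap_mem' c := (differentiableOn_const c).congr fun z hz => by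
    simp [OpenDisk.extend_apply _ hz]

namespace HInfty

/-- The coordinate function `z ↦ z` as an element of `H^∞`. -/
noncomputable def coord : HInfty :=
  ⟨BoundedContinuousFunction.ofNormedAddCommGroup (fun z : OpenDisk => (z : ℂ))
      continuous_subtype_val 1 (fun z => (mem_ball_zero_iff.mp z.2).le),
    differentiableOn_id.congr fun z hz => by simp [OpenDisk.extend_apply _ hz]⟩

/-- The integral `∫ f(r ζ) g(ζ) dζ` over the unit circle, with respect to normalized arc length,
for `f ∈ H^∞` and `g ∈ L¹` of the circle; the circle is `ℝ / ℤ`, with `ζ = exp (2 π i t)`. -/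
noncomputable def radialIntegral (f : HInfty)
    (g : MeasureTheory.Lp ℂ 1 (AddCircle.haarAddCircle (T := (1 : ℝ)))) (r : ℝ) : ℂ :=
  ∫ t : AddCircle (1 : ℝ), OpenDisk.extend f.1 ((r : ℂ) * (AddCircle.toCircle t : ℂ)) * g t
    ∂AddCircle.haarAddCircle

theorem mul_toCircle_mem {r : ℝ} (hr : r ∈ Set.Ioo (0 : ℝ) 1) (t : AddCircle (1 : ℝ)) :
    (r : ℂ) * (AddCircle.toCircle t : ℂ) ∈ Metric.ball (0 : ℂ) 1 := by
  rw [mem_ball_zero_iff, norm_mul, Circle.norm_coe, mul_one, Complex.norm_real, Real.norm_eq_abs,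
    abs_of_pos hr.1]
  exact hr.2

theorem norm_extend_le (f : HInfty) (z : ℂ) : ‖OpenDisk.extend f.1 z‖ ≤ ‖f‖ := by
  by_cases hz : z ∈ Metric.ball (0 : ℂ) 1
  · rw [OpenDisk.extend_apply _ hz]
    exact f.1.norm_coe_le_norm _
  · have h : OpenDisk.extend f.1 z = 0 :=
      Function.extend_apply' _ _ _ (by rintro ⟨w, rfl⟩; exact hz w.2)
    rw [h, norm_zero]
    exact norm_nonneg f

theorem continuous_radial (f : HInfty) {r : ℝ} (hr : r ∈ Set.Ioo (0 : ℝ) 1) :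
    Continuous fun t : AddCircle (1 : ℝ) =>
      OpenDisk.extend f.1 ((r : ℂ) * (AddCircle.toCircle t : ℂ)) :=
  f.2.continuousOn.comp_continuous
    (continuous_const.mul (continuous_subtype_val.comp AddCircle.continuous_toCircle))
    (mul_toCircle_mem hr)

theorem integrable_radial (f : HInfty)
    (g : MeasureTheory.Lp ℂ 1 (AddCircle.haarAddCircle (T := (1 : ℝ)))) {r : ℝ}
    (hr : r ∈ Set.Ioo (0 : ℝ) 1) :
    MeasureTheory.Integrable (fun t : AddCircle (1 : ℝ) =>
      OpenDisk.extend f.1 ((r : ℂ) * (AddCircle.toCircle t : ℂ)) * g t)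
      AddCircle.haarAddCircle :=
  (MeasureTheory.L1.integrable_coeFn g).bdd_mul
    (continuous_radial f hr).aestronglyMeasurable
    (Filter.Eventually.of_forall fun _ => norm_extend_le f _)

theorem radialIntegral_add (f : HInfty)
    (g h : MeasureTheory.Lp ℂ 1 (AddCircle.haarAddCircle (T := (1 : ℝ)))) {r : ℝ}
    (hr : r ∈ Set.Ioo (0 : ℝ) 1) :
    radialIntegral f (g + h) r = radialIntegral f g r + radialIntegral f h r := by
  rw [radialIntegral, radialIntegral, radialIntegral,
    ← MeasureTheory.integral_add (integrable_radial f g hr) (integrable_radial f h hr)]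
  refine MeasureTheory.integral_congr_ae ?_
  filter_upwards [MeasureTheory.Lp.coeFn_add g h] with t ht
  rw [ht, Pi.add_apply, mul_add]

theorem radialIntegral_smul (f : HInfty) (c : ℂ)
    (g : MeasureTheory.Lp ℂ 1 (AddCircle.haarAddCircle (T := (1 : ℝ)))) (r : ℝ) :
    radialIntegral f (c • g) r = c * radialIntegral f g r := by
  rw [radialIntegral, radialIntegral, ← MeasureTheory.integral_const_mul]
  refine MeasureTheory.integral_congr_ae ?_
  filter_upwards [MeasureTheory.Lp.coeFn_smul c g] with t ht
  rw [ht, Pi.smul_apply, smul_eq_mul, mul_left_comm]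

theorem norm_radialIntegral_le (f : HInfty)
    (g : MeasureTheory.Lp ℂ 1 (AddCircle.haarAddCircle (T := (1 : ℝ)))) (r : ℝ) :
    ‖radialIntegral f g r‖ ≤ ‖f‖ * ‖g‖ := by
  rw [MeasureTheory.L1.norm_eq_integral_norm, ← MeasureTheory.integral_const_mul]
  refine MeasureTheory.norm_integral_le_of_norm_le
    ((MeasureTheory.L1.integrable_coeFn g).norm.const_mul _) (Filter.Eventually.of_forall ?_)
  intro t
  rw [norm_mul]
  gcongr
  exact norm_extend_le f _

theorem integral_fourier (m : ℤ) :
    ∫ t : AddCircle (1 : ℝ), fourier m t ∂AddCircle.haarAddCircle = if m = 0 then 1 else 0 := by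
  have h := congrFun (fourierCoeff_fourier (T := (1 : ℝ)) m) 0
  have h0 : fourierCoeff (T := (1 : ℝ)) (fourier m) 0 =
      ∫ t : AddCircle (1 : ℝ), fourier m t ∂AddCircle.haarAddCircle :=
    MeasureTheory.integral_congr_ae (Filter.Eventually.of_forall fun t => by
      show fourier (-0) t • fourier m t = fourier m t
      rw [neg_zero, fourier_zero, one_smul])
  rw [← h0, h, Pi.single_apply]
  by_cases hm : m = 0
  · rw [if_pos hm, if_pos hm.symm]
  · rw [if_neg hm, if_neg (Ne.symm hm)]

theorem exists_tendsto_radialIntegral_fourier (f : HInfty) (n : ℤ) :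
    ∃ c, Filter.Tendsto (radialIntegral f (fourierLp 1 n)) (𝓝[<] (1 : ℝ)) (𝓝 c) := by
  set a : ℕ → ℂ := fun k => (k.factorial : ℂ)⁻¹ * iteratedDeriv k (OpenDisk.extend f.1) 0 with ha
  have hsum : ∀ z ∈ Metric.ball (0 : ℂ) 1,
      HasSum (fun k : ℕ => a k * z ^ k) (OpenDisk.extend f.1 z) := by
    intro z hz
    have h := Complex.hasSum_taylorSeries_on_ball f.2 hz
    have e : (fun k : ℕ => a k * z ^ k) = fun k : ℕ => (k.factorial : ℂ)⁻¹ • (z - 0) ^ k •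
        iteratedDeriv k (OpenDisk.extend f.1) 0 := by
      funext k
      simp only [ha, sub_zero, smul_eq_mul]
      ring
    rw [e]
    exact h
  have key : ∀ r ∈ Set.Ioo (0 : ℝ) 1, radialIntegral f (fourierLp 1 n) r =
      ∑' k : ℕ, a k * (r : ℂ) ^ k * (if (k : ℤ) + n = 0 then 1 else 0) := by
    intro r hr
    have e : radialIntegral f (fourierLp 1 n) r = ∫ t : AddCircle (1 : ℝ),
        ∑' k : ℕ, a k * (r : ℂ) ^ k * fourier ((k : ℤ) + n) t ∂AddCircle.haarAddCircle := by
      refine MeasureTheory.integral_congr_ae ?_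
      filter_upwards [coeFn_fourierLp (T := (1 : ℝ)) 1 n] with t ht
      rw [ht, ← (hsum _ (mul_toCircle_mem hr t)).tsum_eq, ← tsum_mul_right]
      refine tsum_congr fun k => ?_
      have hk : (fourier (k : ℤ) t : ℂ) = (AddCircle.toCircle t : ℂ) ^ k := by
        rw [fourier_apply, natCast_zsmul, AddCircle.toCircle_nsmul, Circle.coe_pow]
      rw [fourier_add, mul_pow, hk]
      ring
    have hs : Summable fun k : ℕ => ‖a k * (r : ℂ) ^ k‖ := by
      refine (hsum (r : ℂ) ?_).summable.norm
      simpa using mul_toCircle_mem hr 0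
    rw [e]
    have H := MeasureTheory.hasSum_integral_of_summable_integral_norm
      (μ := AddCircle.haarAddCircle (T := (1 : ℝ)))
      (F := fun (k : ℕ) (t : AddCircle (1 : ℝ)) => a k * (r : ℂ) ^ k * fourier ((k : ℤ) + n) t)
      (fun k => ((map_continuous (fourier ((k : ℤ) + n))).integrable_of_hasCompactSupport
        (HasCompactSupport.of_compactSpace _)).const_mul _)
      (by
        refine hs.congr fun k => ?_
        have hn : ∀ t : AddCircle (1 : ℝ), ‖a k * (r : ℂ) ^ k * fourier ((k : ℤ) + n) t‖ =
            ‖a k * (r : ℂ) ^ k‖ := fun t => by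
          rw [norm_mul, fourier_apply, Circle.norm_coe, mul_one]
        simp only [hn]
        simp)
    rw [← H.tsum_eq]
    refine tsum_congr fun k => ?_
    rw [MeasureTheory.integral_const_mul, integral_fourier]
  have hev : ∀ᶠ r : ℝ in 𝓝[<] (1 : ℝ), r ∈ Set.Ioo (0 : ℝ) 1 := Ioo_mem_nhdsLT one_pos
  by_cases hn : n ≤ 0
  · obtain ⟨m, rfl⟩ : ∃ m : ℕ, n = -(m : ℤ) := ⟨n.natAbs, by omega⟩
    refine ⟨a m * ((1 : ℝ) : ℂ) ^ m, Filter.Tendsto.congr' (f₁ := fun r : ℝ => a m * (r : ℂ) ^ m) ?_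
      (Continuous.tendsto (by fun_prop) _ |>.mono_left nhdsWithin_le_nhds)⟩
    filter_upwards [hev] with r hr
    rw [key r hr, tsum_eq_single m]
    · simp
    · intro k hk
      rw [if_neg (by omega), mul_zero]
  · refine ⟨0, Filter.Tendsto.congr' (f₁ := fun _ : ℝ => 0) ?_ tendsto_const_nhds⟩
    filter_upwards [hev] with r hr
    rw [key r hr]
    have : ∀ k : ℕ, ¬ ((k : ℤ) + n = 0) := fun k => by omega
    simp [this]

/-- The limit in the definition of the pairing below exists. -/
theorem exists_tendsto_radialIntegral (f : HInfty)
    (g : MeasureTheory.Lp ℂ 1 (AddCircle.haarAddCircle (T := (1 : ℝ)))) :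
    ∃ c, Filter.Tendsto (radialIntegral f g) (𝓝[<] (1 : ℝ)) (𝓝 c) := by
  have hev : ∀ᶠ r : ℝ in 𝓝[<] (1 : ℝ), r ∈ Set.Ioo (0 : ℝ) 1 := Ioo_mem_nhdsLT one_pos
  have hspan : ∀ h ∈ Submodule.span ℂ (Set.range (fourierLp (T := (1 : ℝ)) 1)),
      ∃ c, Filter.Tendsto (radialIntegral f h) (𝓝[<] (1 : ℝ)) (𝓝 c) := by
    intro h hh
    induction hh using Submodule.span_induction with
    | mem x hx =>
      obtain ⟨n, rfl⟩ := hx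
      exact exists_tendsto_radialIntegral_fourier f n
    | zero =>
      refine ⟨0, Filter.Tendsto.congr (f₁ := fun _ => 0) (fun r => ?_) tendsto_const_nhds⟩
      have := radialIntegral_smul f 0 0 r
      rw [zero_smul, zero_mul] at this
      exact this.symm
    | add x y _ _ hx hy =>
      obtain ⟨c, hc⟩ := hx
      obtain ⟨d, hd⟩ := hy
      refine ⟨c + d, (hc.add hd).congr' ?_⟩
      filter_upwards [hev] with r hr
      exact (radialIntegral_add f x y hr).symm
    | smul b x _ hx =>
      obtain ⟨c, hc⟩ := hx
      exact ⟨b * c, (hc.const_mul b).congr fun r => (radialIntegral_smul f b x r).symm⟩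
  have hg : g ∈ closure (Submodule.span ℂ (Set.range (fourierLp (T := (1 : ℝ)) 1)) :
      Set (MeasureTheory.Lp ℂ 1 (AddCircle.haarAddCircle (T := (1 : ℝ))))) := by
    have h := span_fourierLp_closure_eq_top (T := (1 : ℝ)) (p := 1) ENNReal.one_ne_top
    rw [← Submodule.topologicalClosure_coe, h]
    trivial
  refine cauchy_map_iff_exists_tendsto.mp (Metric.cauchy_iff.mpr ⟨inferInstance, fun ε hε => ?_⟩)
  have hδ : 0 < ε / (4 * (‖f‖ + 1)) := by positivity
  obtain ⟨h, hh, hgh⟩ := Metric.mem_closure_iff.mp hg _ hδ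
  obtain ⟨c, hc⟩ := hspan h hh
  have h1 : ∀ᶠ r in 𝓝[<] (1 : ℝ), dist (radialIntegral f g r) c < ε / 2 := by
    filter_upwards [hev, Metric.tendsto_nhds.mp hc (ε / 4) (by positivity)] with r hr hr'
    have e1 : radialIntegral f g r = radialIntegral f (g - h) r + radialIntegral f h r := by
      rw [← radialIntegral_add f _ _ hr, sub_add_cancel]
    have e2 : ‖radialIntegral f (g - h) r‖ < ε / 4 := by
      refine (norm_radialIntegral_le f (g - h) r).trans_lt ?_
      rw [dist_eq_norm, lt_div_iff₀ (by positivity)] at hgh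
      nlinarith [norm_nonneg (g - h), norm_nonneg f]
    rw [dist_eq_norm] at hr' ⊢
    rw [e1, add_sub_assoc]
    linarith [norm_add_le (radialIntegral f (g - h) r) (radialIntegral f h r - c)]
  refine ⟨_, Filter.image_mem_map h1, ?_⟩
  rintro _ ⟨r, hr, rfl⟩ _ ⟨s, hs, rfl⟩
  have hr' : dist (radialIntegral f g r) c < ε / 2 := hr
  have hs' : dist (radialIntegral f g s) c < ε / 2 := hs
  linarith [dist_triangle_right (radialIntegral f g r) (radialIntegral f g s) c]

/-- The pairing of `f ∈ H^∞` with `g ∈ L¹` of the unit circle,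
`⟨f, g⟩ = lim_{r → 1⁻} ∫ f(r ζ) g(ζ) dζ`.
The functions `ζ ↦ f(r ζ)` are bounded by `‖f‖` and converge almost everywhere to the boundary
function `f*` of `f`, so that the limit is `∫ f*(ζ) g(ζ) dζ`. -/
noncomputable def pairing (f : HInfty)
    (g : MeasureTheory.Lp ℂ 1 (AddCircle.haarAddCircle (T := (1 : ℝ)))) : ℂ :=
  Filter.limUnder (𝓝[<] (1 : ℝ)) (radialIntegral f g)

theorem tendsto_pairing (f : HInfty)
    (g : MeasureTheory.Lp ℂ 1 (AddCircle.haarAddCircle (T := (1 : ℝ)))) :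
    Filter.Tendsto (radialIntegral f g) (𝓝[<] (1 : ℝ)) (𝓝 (pairing f g)) :=
  tendsto_nhds_limUnder (exists_tendsto_radialIntegral f g)

/-- The weak* topology of `H^∞`, as a subspace of `L^∞` of the circle, the dual of `L¹`: the
coarsest topology that makes `f ↦ ⟨f, g⟩` continuous for every `g ∈ L¹`. -/
noncomputable abbrev weakStarTopology : TopologicalSpace HInfty :=
  ⨅ g : MeasureTheory.Lp ℂ 1 (AddCircle.haarAddCircle (T := (1 : ℝ))),
    TopologicalSpace.induced (fun f : HInfty => pairing f g) inferInstance

end HInfty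

/-- The weak* (also: ultraweak, `σ`-weak) topology on the bounded operators of a Hilbert space, the
dual of the trace class operators: the coarsest topology that makes `A ↦ ∑ₖ ⟨A xₖ, yₖ⟩`
continuous for all square-summable sequences of vectors `(xₖ)` and `(yₖ)`. -/
noncomputable abbrev operatorWeakStarTopology (E : Type*) [NormedAddCommGroup E]
    [InnerProductSpace ℂ E] : TopologicalSpace (E →L[ℂ] E) :=
  ⨅ p : lp (fun _ : ℕ => E) 2 × lp (fun _ : ℕ => E) 2,
    TopologicalSpace.induced (fun A : E →L[ℂ] E => ∑' k, ⟪p.2 k, A (p.1 k)⟫_ℂ) inferInstance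

/-- `Φ` is an `H^∞` functional calculus `f ↦ f(A)` for the operator `A`: a unital algebra
homomorphism that maps the coordinate function to `A`, does not increase norms, and is continuous
for the weak* topologies. -/
structure IsHInftyFunctionalCalculus {E : Type*} [NormedAddCommGroup E] [InnerProductSpace ℂ E]
    (A : E →L[ℂ] E) (Φ : HInfty →ₐ[ℂ] (E →L[ℂ] E)) : Prop where
  map_coord : Φ HInfty.coord = A
  norm_map_le : ∀ f, ‖Φ f‖ ≤ ‖f‖
  continuous : Continuous[HInfty.weakStarTopology, operatorWeakStarTopology E] Φ

/-! The proof has two independent halves: the powers of the adjoint `T` of `L` tend strongly to `0`,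
and any contraction with this property has a weak*-continuous calculus.

Stability (`tendsto_adjoint_pow`): `L` commutes with all right shifts, so it is determined by its
value at the vacuum vector, and `T` is triangular with respect to word length. Modulo shorter words,
`T ξ_w` is a fixed scalar multiple of `ξ_w`; the scalar is the conjugate of the vacuum coefficient
`c` of `L`. If `|c| = 1`, equality in Cauchy–Schwarz makes `L` the scalar `c`, hence unitary.
Otherwise `|c| < 1`, and induction on word length proves stability of each `ξ_w`.

Calculus (`exists_isHInftyFunctionalCalculus`): with `D = (1 - T*T)^(1/2)`, the map `x ↦ (D Tᵏ x)ₖ`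
is an isometry carrying `T` to a backward shift. Reading sequences as Fourier series embeds the
space in vector-valued `L²` of the circle by an isometry `J`. The pointwise inner product of `J y`
and `J x` is an `L¹` density whose frequencies `k ≥ 0` are `⟨y, Lᵏ x⟩`. Pairing `f` with this
density gives the matrix coefficients of `f(L)`. The norm bound and weak* continuity come from `‖G y
x‖₁ ≤ ‖y‖ ‖x‖`; multiplicativity comes from approximating `f` by its dilations `f(r z)`. -/

/-- The space `L¹` of the circle with normalized arc length. -/
abbrev CircleL1 : Type := MeasureTheory.Lp ℂ 1 (AddCircle.haarAddCircle (T := (1 : ℝ)))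

/-! ### Fourier functionals on `L¹` of the circle. -/

theorem norm_fourier_apply (k : ℤ) (t : AddCircle (1 : ℝ)) : ‖(fourier k t : ℂ)‖ = 1 := by
  rw [fourier_apply, Circle.norm_coe]

theorem fourier_natCast_apply (k : ℕ) (t : AddCircle (1 : ℝ)) :
    (fourier (k : ℤ) t : ℂ) = (AddCircle.toCircle t : ℂ) ^ k := by
  rw [fourier_apply, natCast_zsmul, AddCircle.toCircle_nsmul, Circle.coe_pow]

namespace CircleL1

theorem integrable_fourier_mul (k : ℤ) (g : CircleL1) :
    MeasureTheory.Integrable (fun t : AddCircle (1 : ℝ) => fourier k t * g t)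
      AddCircle.haarAddCircle :=
  (MeasureTheory.L1.integrable_coeFn g).bdd_mul (c := 1)
    (map_continuous (fourier k)).aestronglyMeasurable
    (Filter.Eventually.of_forall fun t => (norm_fourier_apply k t).le)

/-- The functional `g ↦ ∫ ζ ^ k g(ζ) dζ` on `L¹`. -/
noncomputable def fourierIntegral (k : ℤ) : CircleL1 →L[ℂ] ℂ :=
  LinearMap.mkContinuous
    { toFun := fun g => ∫ t : AddCircle (1 : ℝ), fourier k t * g t ∂AddCircle.haarAddCircle
      map_add' := fun g h => by
        rw [← MeasureTheory.integral_add (integrable_fourier_mul k g) (integrable_fourier_mul k h)]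
        refine MeasureTheory.integral_congr_ae ?_
        filter_upwards [MeasureTheory.Lp.coeFn_add g h] with t ht
        rw [ht, Pi.add_apply, mul_add]
      map_smul' := fun c g => by
        rw [RingHom.id_apply, smul_eq_mul, ← MeasureTheory.integral_const_mul]
        refine MeasureTheory.integral_congr_ae ?_
        filter_upwards [MeasureTheory.Lp.coeFn_smul c g] with t ht
        rw [ht, Pi.smul_apply, smul_eq_mul, mul_left_comm] }
    1 (fun g => by
      rw [one_mul, MeasureTheory.L1.norm_eq_integral_norm]
      refine MeasureTheory.norm_integral_le_of_norm_le
        (MeasureTheory.L1.integrable_coeFn g).norm (Filter.Eventually.of_forall fun t => ?_)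
      rw [norm_mul, norm_fourier_apply, one_mul])

theorem fourierIntegral_apply (k : ℤ) (g : CircleL1) :
    fourierIntegral k g =
      ∫ t : AddCircle (1 : ℝ), fourier k t * g t ∂AddCircle.haarAddCircle := rfl

end CircleL1

/-! ### The pairing of `H^∞` with `L¹` through Taylor series. -/

namespace HInfty
open CircleL1

/-- The Taylor coefficients of `f` at `0`. -/
noncomputable def taylorCoeff (f : HInfty) (k : ℕ) : ℂ :=
  (k.factorial : ℂ)⁻¹ * iteratedDeriv k (OpenDisk.extend f.1) 0

theorem hasSum_taylorCoeff (f : HInfty) {z : ℂ} (hz : z ∈ Metric.ball (0 : ℂ) 1) :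
    HasSum (fun k : ℕ => taylorCoeff f k * z ^ k) (OpenDisk.extend f.1 z) := by
  have h := Complex.hasSum_taylorSeries_on_ball f.2 hz
  have e : (fun k : ℕ => taylorCoeff f k * z ^ k) = fun k : ℕ => (k.factorial : ℂ)⁻¹ •
      (z - 0) ^ k • iteratedDeriv k (OpenDisk.extend f.1) 0 := by
    funext k
    simp only [taylorCoeff, sub_zero, smul_eq_mul]
    ring
  rw [e]
  exact h

theorem ofReal_mem_ball {r : ℝ} (hr : r ∈ Set.Ioo (0 : ℝ) 1) :
    (r : ℂ) ∈ Metric.ball (0 : ℂ) 1 := by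
  simpa using mul_toCircle_mem hr 0

/-- At radius `r < 1` the Taylor series converges absolutely, so `∑ ‖aₖ rᵏ‖ ‖g‖` justifies
exchanging sum and integral. The factor `ζ ^ m` prepares for multiplication by powers of the
coordinate function. -/
theorem hasSum_integral_taylorCoeff (f : HInfty) (g : CircleL1) (m : ℕ) {r : ℝ}
    (hr : r ∈ Set.Ioo (0 : ℝ) 1) :
    HasSum (fun k : ℕ => taylorCoeff f k * (r : ℂ) ^ k * fourierIntegral ((k + m : ℕ) : ℤ) g)
      (∫ t : AddCircle (1 : ℝ), OpenDisk.extend f.1 ((r : ℂ) * (AddCircle.toCircle t : ℂ)) *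
        (fourier (m : ℤ) t * g t) ∂AddCircle.haarAddCircle) := by
  have hs : Summable fun k : ℕ => ‖taylorCoeff f k * (r : ℂ) ^ k‖ :=
    (hasSum_taylorCoeff f (ofReal_mem_ball hr)).summable.norm
  have H := MeasureTheory.hasSum_integral_of_summable_integral_norm
    (μ := AddCircle.haarAddCircle (T := (1 : ℝ)))
    (F := fun (k : ℕ) (t : AddCircle (1 : ℝ)) =>
      taylorCoeff f k * (r : ℂ) ^ k * (fourier ((k + m : ℕ) : ℤ) t * g t))
    (fun k => (integrable_fourier_mul _ g).const_mul _)
    (by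
      refine (hs.mul_right ‖g‖).congr fun k => ?_
      rw [MeasureTheory.L1.norm_eq_integral_norm, ← MeasureTheory.integral_const_mul]
      refine MeasureTheory.integral_congr_ae (Filter.Eventually.of_forall fun t => ?_)
      simp only [norm_mul, norm_fourier_apply, one_mul])
  have e : (∫ t : AddCircle (1 : ℝ), OpenDisk.extend f.1 ((r : ℂ) * (AddCircle.toCircle t : ℂ)) *
        (fourier (m : ℤ) t * g t) ∂AddCircle.haarAddCircle) = ∫ t : AddCircle (1 : ℝ),
        ∑' k : ℕ, taylorCoeff f k * (r : ℂ) ^ k * (fourier ((k + m : ℕ) : ℤ) t * g t)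
          ∂AddCircle.haarAddCircle := by
    refine MeasureTheory.integral_congr_ae (Filter.Eventually.of_forall fun t => ?_)
    dsimp only
    rw [← (hasSum_taylorCoeff f (mul_toCircle_mem hr t)).tsum_eq, ← tsum_mul_right]
    refine tsum_congr fun k => ?_
    rw [fourier_natCast_apply, fourier_natCast_apply, mul_pow, pow_add]
    ring
  rw [e]
  refine H.congr_fun fun k => ?_
  rw [MeasureTheory.integral_const_mul, fourierIntegral_apply]

theorem hasSum_radialIntegral (f : HInfty) (g : CircleL1) {r : ℝ} (hr : r ∈ Set.Ioo (0 : ℝ) 1) :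
    HasSum (fun k : ℕ => taylorCoeff f k * (r : ℂ) ^ k * fourierIntegral (k : ℤ) g)
      (radialIntegral f g r) := by
  simpa [radialIntegral] using hasSum_integral_taylorCoeff f g 0 hr

theorem eventually_mem_Ioo : ∀ᶠ r : ℝ in 𝓝[<] (1 : ℝ), r ∈ Set.Ioo (0 : ℝ) 1 :=
  Ioo_mem_nhdsLT one_pos

theorem extend_coord_pow_mul (f : HInfty) (m : ℕ) {z : ℂ} (hz : z ∈ Metric.ball (0 : ℂ) 1) :
    OpenDisk.extend (coord ^ m * f).1 z = z ^ m * OpenDisk.extend f.1 z := by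
  rw [OpenDisk.extend_apply _ hz, OpenDisk.extend_apply _ hz]
  rfl

/-- The pairing with `f` depends only on the nonnegative frequencies, and multiplication of `f`
by the coordinate function shifts them. -/
theorem pairing_coord_pow_mul (f : HInfty) (m : ℕ) (g h : CircleL1)
    (hgh : ∀ k : ℕ, fourierIntegral ((k + m : ℕ) : ℤ) g = fourierIntegral (k : ℤ) h) :
    pairing (coord ^ m * f) g = pairing f h := by
  have h1 : Filter.Tendsto (fun r : ℝ => (r : ℂ) ^ m * radialIntegral f h r) (𝓝[<] (1 : ℝ))
      (𝓝 (((1 : ℝ) : ℂ) ^ m * pairing f h)) :=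
    ((Continuous.tendsto (by fun_prop) _).mono_left nhdsWithin_le_nhds).mul (tendsto_pairing f h)
  rw [Complex.ofReal_one, one_pow, one_mul] at h1
  refine tendsto_nhds_unique (tendsto_pairing _ g) (h1.congr' ?_)
  filter_upwards [eventually_mem_Ioo] with r hr
  have h2 := hasSum_integral_taylorCoeff f g m hr
  simp only [hgh] at h2
  rw [(hasSum_radialIntegral f h hr).unique h2, radialIntegral,
    ← MeasureTheory.integral_const_mul]
  refine MeasureTheory.integral_congr_ae (Filter.Eventually.of_forall fun t => ?_)
  dsimp only
  rw [extend_coord_pow_mul f m (mul_toCircle_mem hr t), fourier_natCast_apply, mul_pow]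
  ring

theorem pairing_congr (f : HInfty) (g h : CircleL1)
    (hgh : ∀ k : ℕ, fourierIntegral (k : ℤ) g = fourierIntegral (k : ℤ) h) :
    pairing f g = pairing f h := by
  simpa using pairing_coord_pow_mul f 0 g h hgh

theorem extend_add (f h : HInfty) (z : ℂ) :
    OpenDisk.extend (f + h).1 z = OpenDisk.extend f.1 z + OpenDisk.extend h.1 z := by
  by_cases hz : z ∈ Metric.ball (0 : ℂ) 1
  · simp only [OpenDisk.extend_apply _ hz]
    rfl
  · have hz' : ¬ ∃ w : OpenDisk, (w : ℂ) = z := by rintro ⟨w, rfl⟩; exact hz w.2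
    simp [OpenDisk.extend, Function.extend_apply' _ _ _ hz']

theorem extend_smul (c : ℂ) (f : HInfty) (z : ℂ) :
    OpenDisk.extend (c • f).1 z = c * OpenDisk.extend f.1 z := by
  by_cases hz : z ∈ Metric.ball (0 : ℂ) 1
  · simp only [OpenDisk.extend_apply _ hz]
    rfl
  · have hz' : ¬ ∃ w : OpenDisk, (w : ℂ) = z := by rintro ⟨w, rfl⟩; exact hz w.2
    simp [OpenDisk.extend, Function.extend_apply' _ _ _ hz']

theorem norm_pairing_le (f : HInfty) (g : CircleL1) : ‖pairing f g‖ ≤ ‖f‖ * ‖g‖ :=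
  le_of_tendsto (tendsto_pairing f g).norm
    (Filter.Eventually.of_forall fun r => norm_radialIntegral_le f g r)

/-- The pairing of `H^∞` and `L¹` as a bounded bilinear map. -/
noncomputable def pairingCLM : HInfty →L[ℂ] CircleL1 →L[ℂ] ℂ :=
  LinearMap.mkContinuous₂
    (LinearMap.mk₂ ℂ pairing
      (fun f h g => by
        refine tendsto_nhds_unique (tendsto_pairing _ g)
          (((tendsto_pairing f g).add (tendsto_pairing h g)).congr' ?_)
        filter_upwards [eventually_mem_Ioo] with r hr
        rw [radialIntegral, radialIntegral, radialIntegral, ← MeasureTheory.integral_add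
          (integrable_radial f g hr) (integrable_radial h g hr)]
        refine MeasureTheory.integral_congr_ae (Filter.Eventually.of_forall fun t => ?_)
        simp only [extend_add, add_mul])
      (fun c f g => by
        refine tendsto_nhds_unique (tendsto_pairing _ g)
          (((tendsto_pairing f g).const_mul c).congr fun r => ?_)
        rw [radialIntegral, radialIntegral, ← MeasureTheory.integral_const_mul]
        refine MeasureTheory.integral_congr_ae (Filter.Eventually.of_forall fun t => ?_)
        simp only [extend_smul, mul_assoc])
      (fun f g h => by
        refine tendsto_nhds_unique (tendsto_pairing f _)
          (((tendsto_pairing f g).add (tendsto_pairing f h)).congr' ?_)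
        filter_upwards [eventually_mem_Ioo] with r hr
        exact (radialIntegral_add f g h hr).symm)
      (fun c f g => tendsto_nhds_unique (tendsto_pairing f _)
          (((tendsto_pairing f g).const_mul c).congr fun r => (radialIntegral_smul f c g r).symm)))
    1 (fun f g => by
      rw [one_mul]
      exact norm_pairing_le f g)

theorem pairingCLM_apply (f : HInfty) (g : CircleL1) : pairingCLM f g = pairing f g := rfl

theorem pairing_one (g : CircleL1) : pairing 1 g = fourierIntegral 0 g := by
  refine tendsto_nhds_unique (tendsto_pairing 1 g) (tendsto_const_nhds.congr' ?_)
  filter_upwards [eventually_mem_Ioo] with r hr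
  rw [radialIntegral, fourierIntegral_apply]
  refine MeasureTheory.integral_congr_ae (Filter.Eventually.of_forall fun t => ?_)
  dsimp only
  rw [OpenDisk.extend_apply _ (mul_toCircle_mem hr t), fourier_zero]
  rfl

/-! ### Dilations -/

theorem ofReal_mul_mem_ball {r : ℝ} (hr : r ∈ Set.Ioo (0 : ℝ) 1) {z : ℂ}
    (hz : z ∈ Metric.ball (0 : ℂ) 1) : (r : ℂ) * z ∈ Metric.ball (0 : ℂ) 1 := by
  rw [mem_ball_zero_iff] at hz ⊢
  rw [norm_mul, Complex.norm_real, Real.norm_eq_abs, abs_of_pos hr.1]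
  nlinarith [hr.1, hr.2, norm_nonneg z]

/-- The dilation `z ↦ f(r z)` of `f ∈ H^∞`, for `0 < r < 1`. -/
noncomputable def dilate (f : HInfty) (r : Set.Ioo (0 : ℝ) 1) : HInfty :=
  ⟨BoundedContinuousFunction.ofNormedAddCommGroup
      (fun z : OpenDisk => OpenDisk.extend f.1 ((r : ℝ) * (z : ℂ)))
      (f.2.continuousOn.comp_continuous (by fun_prop) fun z => ofReal_mul_mem_ball r.2 z.2)
      ‖f‖ (fun z => norm_extend_le f _),
    (DifferentiableOn.comp f.2 (f := fun z : ℂ => ((r : ℝ) : ℂ) * z)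
      (by fun_prop) (fun z hz => ofReal_mul_mem_ball r.2 hz)).congr fun z hz => by
        rw [OpenDisk.extend_apply _ hz]
        rfl⟩

theorem extend_dilate (f : HInfty) (r : Set.Ioo (0 : ℝ) 1) {z : ℂ}
    (hz : z ∈ Metric.ball (0 : ℂ) 1) :
    OpenDisk.extend (dilate f r).1 z = OpenDisk.extend f.1 ((r : ℝ) * z) := by
  rw [OpenDisk.extend_apply _ hz]
  rfl

theorem norm_dilate_le (f : HInfty) (r : Set.Ioo (0 : ℝ) 1) : ‖dilate f r‖ ≤ ‖f‖ :=
  BoundedContinuousFunction.norm_ofNormedAddCommGroup_le _ (norm_nonneg f)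
    fun _ => norm_extend_le f _

theorem coord_pow_apply (k : ℕ) (z : OpenDisk) : (coord ^ k).1 z = (z : ℂ) ^ k := rfl

theorem norm_coord_pow_le (k : ℕ) : ‖coord ^ k‖ ≤ 1 := by
  refine (BoundedContinuousFunction.norm_le zero_le_one).mpr fun z => ?_
  change ‖(coord ^ k).1 z‖ ≤ 1
  rw [coord_pow_apply, norm_pow]
  exact pow_le_one₀ (norm_nonneg _) (mem_ball_zero_iff.mp z.2).le

/-- The Taylor series of a dilation converges in norm. -/
theorem hasSum_dilate (f : HInfty) (r : Set.Ioo (0 : ℝ) 1) :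
    HasSum (fun k : ℕ => (taylorCoeff f k * ((r : ℝ) : ℂ) ^ k) • coord ^ k) (dilate f r) := by
  have hs : Summable fun k : ℕ => ‖taylorCoeff f k * ((r : ℝ) : ℂ) ^ k‖ :=
    (hasSum_taylorCoeff f (ofReal_mem_ball r.2)).summable.norm
  -- Convergence is obtained in the complete space of bounded continuous functions; the sum is then
  -- identified with the dilation by evaluating at points.
  have hs' : Summable fun k : ℕ =>
      (taylorCoeff f k * ((r : ℝ) : ℂ) ^ k) • (coord ^ k).1 := by
    refine Summable.of_norm_bounded hs fun k => ?_
    refine (norm_smul_le (taylorCoeff f k * ((r : ℝ) : ℂ) ^ k) (coord ^ k).1).trans ?_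
    exact mul_le_of_le_one_right (norm_nonneg _) (norm_coord_pow_le k)
  have hind : Topology.IsInducing (HInfty.val : HInfty →ₐ[ℂ] (OpenDisk →ᵇ ℂ)) :=
    Topology.IsInducing.subtypeVal
  rw [← hind.hasSum_iff]
  have e : HInfty.val (dilate f r) =
      ∑' k : ℕ, (taylorCoeff f k * ((r : ℝ) : ℂ) ^ k) • (coord ^ k).1 := by
    ext z
    have h1 := (hs'.hasSum.map (BoundedContinuousFunction.evalCLM ℂ z :
      (OpenDisk →ᵇ ℂ) →L[ℂ] ℂ) (ContinuousLinearMap.continuous _))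
    have h2 := hasSum_taylorCoeff f (ofReal_mul_mem_ball r.2 z.2)
    refine HasSum.unique ?_ h1
    have e2 : HInfty.val (dilate f r) z = OpenDisk.extend f.1 ((r : ℝ) * (z : ℂ)) := rfl
    rw [e2]
    refine h2.congr_fun fun k => ?_
    simp only [Function.comp_apply, BoundedContinuousFunction.evalCLM_apply,
      BoundedContinuousFunction.coe_smul, coord_pow_apply, smul_eq_mul, mul_pow, mul_assoc]
  rw [e]
  exact hs'.hasSum

/-! ### Weak* convergence of dilations. -/

theorem fourierIntegral_fourierLp (k n : ℤ) :
    fourierIntegral k (fourierLp 1 n) = if k + n = 0 then 1 else 0 := by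
  rw [← integral_fourier, fourierIntegral_apply]
  refine MeasureTheory.integral_congr_ae ?_
  filter_upwards [coeFn_fourierLp (T := (1 : ℝ)) 1 n] with t ht
  rw [ht, fourier_add]

theorem radialIntegral_fourierLp_neg (f : HInfty) (n : ℕ) {r : ℝ} (hr : r ∈ Set.Ioo (0 : ℝ) 1) :
    radialIntegral f (fourierLp 1 (-(n : ℤ))) r = taylorCoeff f n * (r : ℂ) ^ n := by
  refine (hasSum_radialIntegral f _ hr).unique ?_
  convert hasSum_single n fun k hk => ?_ using 1
  · simp [fourierIntegral_fourierLp]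
  · rw [fourierIntegral_fourierLp, if_neg (by omega), mul_zero]

theorem pairing_fourierLp_neg (f : HInfty) (n : ℕ) :
    pairing f (fourierLp 1 (-(n : ℤ))) = taylorCoeff f n := by
  have h : Filter.Tendsto (fun r : ℝ => taylorCoeff f n * (r : ℂ) ^ n) (𝓝[<] (1 : ℝ))
      (𝓝 (taylorCoeff f n * ((1 : ℝ) : ℂ) ^ n)) :=
    (Continuous.tendsto (by fun_prop) _).mono_left nhdsWithin_le_nhds
  rw [Complex.ofReal_one, one_pow, mul_one] at h
  refine tendsto_nhds_unique (tendsto_pairing f _) (h.congr' ?_)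
  filter_upwards [eventually_mem_Ioo] with r hr
  exact (radialIntegral_fourierLp_neg f n hr).symm

theorem half_mem_Ioo : (1 / 2 : ℝ) ∈ Set.Ioo (0 : ℝ) 1 := by norm_num

/-- Against a character the radial integral is a monomial in `r`, so the boundary limit can be read
off at one interior radius. This avoids interchanging the limit in the pairing with the limit over
dilations. -/
theorem pairing_fourierLp_neg_eq_half (f : HInfty) (n : ℕ) :
    pairing f (fourierLp 1 (-(n : ℤ))) =
      2 ^ n * radialIntegral f (fourierLp 1 (-(n : ℤ))) (1 / 2) := by
  rw [pairing_fourierLp_neg, radialIntegral_fourierLp_neg f n half_mem_Ioo, mul_left_comm,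
    ← mul_pow]
  norm_num

theorem pairing_fourierLp_of_pos (f : HInfty) {n : ℤ} (hn : 0 < n) :
    pairing f (fourierLp 1 n) = 0 := by
  rw [pairing_congr f (fourierLp 1 n) 0 fun k => ?_, ← pairingCLM_apply, map_zero]
  rw [fourierIntegral_fourierLp, if_neg (by omega), map_zero]

theorem extend_mul (f h : HInfty) {z : ℂ} (hz : z ∈ Metric.ball (0 : ℂ) 1) :
    OpenDisk.extend (f * h).1 z = OpenDisk.extend f.1 z * OpenDisk.extend h.1 z := by
  simp only [OpenDisk.extend_apply _ hz]
  rfl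

/-- The parameter set `(0, 1)` with the filter of neighborhoods of `1`. -/
noncomputable abbrev radii : Filter (Set.Ioo (0 : ℝ) 1) :=
  Filter.comap Subtype.val (𝓝[<] (1 : ℝ))

/-- Dominated convergence: at a fixed interior radius, `f` is continuous at each point `s ζ`, and
the integrands are bounded by `‖f‖ ‖h‖ |g|`. -/
theorem tendsto_radialIntegral_dilate_mul (f h : HInfty) (g : CircleL1) {s : ℝ}
    (hs : s ∈ Set.Ioo (0 : ℝ) 1) :
    Filter.Tendsto (fun r => radialIntegral (dilate f r * h) g s) radii
      (𝓝 (radialIntegral (f * h) g s)) := by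
  refine MeasureTheory.tendsto_integral_filter_of_dominated_convergence
    (fun t => ‖f‖ * ‖h‖ * ‖g t‖) ?_ ?_ ?_ ?_
  · exact Filter.Eventually.of_forall fun r => (integrable_radial _ g hs).aestronglyMeasurable
  · refine Filter.Eventually.of_forall fun r => Filter.Eventually.of_forall fun t => ?_
    rw [norm_mul, extend_mul _ _ (mul_toCircle_mem hs t), norm_mul]
    gcongr
    · exact (norm_extend_le _ _).trans (norm_dilate_le f r)
    · exact norm_extend_le h _
  · exact (MeasureTheory.L1.integrable_coeFn g).norm.const_mul _
  · refine Filter.Eventually.of_forall fun t => Filter.Tendsto.mul_const _ ?_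
    have hz := mul_toCircle_mem hs t
    simp only [extend_mul _ _ hz, extend_dilate _ _ hz]
    refine Filter.Tendsto.mul_const _ ?_
    have hc : ContinuousAt (OpenDisk.extend f.1) ((s : ℂ) * (AddCircle.toCircle t : ℂ)) :=
      f.2.continuousOn.continuousAt (Metric.isOpen_ball.mem_nhds hz)
    refine hc.tendsto.comp ?_
    have h1 : Filter.Tendsto (fun r : ℝ => (r : ℂ) * ((s : ℂ) * (AddCircle.toCircle t : ℂ)))
        (𝓝[<] (1 : ℝ)) (𝓝 (((1 : ℝ) : ℂ) * ((s : ℂ) * (AddCircle.toCircle t : ℂ)))) :=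
      (Continuous.tendsto (by fun_prop) _).mono_left nhdsWithin_le_nhds
    rw [Complex.ofReal_one, one_mul] at h1
    exact h1.comp Filter.tendsto_comap

theorem neBot_radii : radii.NeBot := by
  refine Filter.comap_neBot_iff.mpr fun t ht => ?_
  obtain ⟨r, hr, hr'⟩ := (Filter.Eventually.and ht eventually_mem_Ioo).exists
  exact ⟨⟨r, hr'⟩, hr⟩

/-- Weak* convergence of the products of dilations of `f` with `h`. -/
theorem tendsto_pairing_dilate_mul (f h : HInfty) (g : CircleL1) :
    Filter.Tendsto (fun r => pairing (dilate f r * h) g) radii (𝓝 (pairing (f * h) g)) := by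
  have hspan : ∀ u ∈ Submodule.span ℂ (Set.range (fourierLp (T := (1 : ℝ)) 1)),
      Filter.Tendsto (fun r => pairing (dilate f r * h) u) radii (𝓝 (pairing (f * h) u)) := by
    intro u hu
    simp only [← pairingCLM_apply]
    induction hu using Submodule.span_induction with
    | mem x hx =>
      obtain ⟨n, rfl⟩ := hx
      simp only [pairingCLM_apply]
      rcases lt_or_ge 0 n with hn | hn
      · simp only [pairing_fourierLp_of_pos _ hn]
        exact tendsto_const_nhds
      · obtain ⟨m, rfl⟩ : ∃ m : ℕ, n = -(m : ℤ) := ⟨n.natAbs, by omega⟩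
        simp only [pairing_fourierLp_neg_eq_half]
        exact (tendsto_radialIntegral_dilate_mul f h _ half_mem_Ioo).const_mul _
    | zero => simp only [map_zero]; exact tendsto_const_nhds
    | add x y _ _ hx hy => simp only [map_add]; exact hx.add hy
    | smul b x _ hx => simp only [map_smul]; exact hx.const_smul b
  have hg : g ∈ closure (Submodule.span ℂ (Set.range (fourierLp (T := (1 : ℝ)) 1)) :
      Set CircleL1) := by
    have h := span_fourierLp_closure_eq_top (T := (1 : ℝ)) (p := 1) ENNReal.one_ne_top
    rw [← Submodule.topologicalClosure_coe, h]
    trivial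
  -- All pairings involved are Lipschitz in the `L¹` variable with one common constant, so
  -- convergence passes from the dense span of the characters to `g`.
  have hbound : ∀ F : HInfty, ‖F‖ ≤ ‖f‖ * ‖h‖ → ∀ u : CircleL1,
      dist (pairing F g) (pairing F u) ≤ ‖f‖ * ‖h‖ * dist g u := by
    intro F hF u
    rw [dist_eq_norm, dist_eq_norm, ← pairingCLM_apply, ← pairingCLM_apply, ← map_sub]
    refine (norm_pairing_le F _).trans ?_
    gcongr
  have hn : ∀ r, ‖dilate f r * h‖ ≤ ‖f‖ * ‖h‖ := fun r =>
    (norm_mul_le _ _).trans (by gcongr; exact norm_dilate_le f r)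
  have hn' : ‖f * h‖ ≤ ‖f‖ * ‖h‖ := norm_mul_le _ _
  refine Metric.tendsto_nhds.mpr fun ε hε => ?_
  have hδ : 0 < ε / (4 * (‖f‖ * ‖h‖ + 1)) := by positivity
  obtain ⟨u, hu, hgu⟩ := Metric.mem_closure_iff.mp hg _ hδ
  have hsmall : ‖f‖ * ‖h‖ * dist g u < ε / 4 := by
    rw [lt_div_iff₀ (by positivity)] at hgu
    nlinarith [dist_nonneg (x := g) (y := u), mul_nonneg (norm_nonneg f) (norm_nonneg h)]
  filter_upwards [Metric.tendsto_nhds.mp (hspan u hu) (ε / 2) (by positivity)] with r hr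
  have h1 := hbound _ (hn r) u
  have h2 := hbound _ hn' u
  have h3 := dist_triangle4 (pairing (dilate f r * h) g) (pairing (dilate f r * h) u)
    (pairing (f * h) u) (pairing (f * h) g)
  rw [dist_comm (pairing (f * h) u)] at h3
  linarith

end HInfty

/-! ### From `L¹` densities to a functional calculus. -/

section FunctionalCalculus
open HInfty CircleL1

variable {E : Type*} [NormedAddCommGroup E] [InnerProductSpace ℂ E] [CompleteSpace E]

/-- The operator `f(A)` determined by `⟨y, f(A) x⟩ = ⟨f, G y x⟩`. -/
noncomputable def operatorOfDensity (G : E →L⋆[ℂ] E →L[ℂ] CircleL1) (f : HInfty) : E →L[ℂ] E :=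
  ContinuousLinearMap.adjoint (InnerProductSpace.continuousLinearMapOfBilin
    ((ContinuousLinearMap.compL ℂ E CircleL1 ℂ (pairingCLM f)).comp G))

theorem inner_operatorOfDensity (G : E →L⋆[ℂ] E →L[ℂ] CircleL1) (f : HInfty) (x y : E) :
    ⟪y, operatorOfDensity G f x⟫_ℂ = pairing f (G y x) := by
  rw [operatorOfDensity, ContinuousLinearMap.adjoint_inner_right,
    InnerProductSpace.continuousLinearMapOfBilin_apply]
  rfl

theorem norm_operatorOfDensity_le (G : E →L⋆[ℂ] E →L[ℂ] CircleL1)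
    (hG : ∀ x y, ‖G y x‖ ≤ ‖y‖ * ‖x‖) (f : HInfty) : ‖operatorOfDensity G f‖ ≤ ‖f‖ := by
  refine ContinuousLinearMap.opNorm_le_bound _ (norm_nonneg f) fun x => ?_
  -- Testing the operator against its own value `z` gives `‖z‖² ≤ ‖f‖ ‖z‖ ‖x‖`.
  set z := operatorOfDensity G f x with hz
  have h : ‖z‖ * ‖z‖ ≤ ‖z‖ * (‖f‖ * ‖x‖) := by
    rw [← inner_self_eq_norm_mul_norm (𝕜 := ℂ)]
    refine (RCLike.re_le_norm _).trans ?_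
    conv_lhs => rw [hz]
    rw [inner_operatorOfDensity]
    calc ‖pairing f (G z x)‖ ≤ ‖f‖ * ‖G z x‖ := norm_pairing_le f _
      _ ≤ ‖f‖ * (‖z‖ * ‖x‖) := by gcongr; exact hG x z
      _ = ‖z‖ * (‖f‖ * ‖x‖) := by ring
  rcases (norm_nonneg z).eq_or_lt with h0 | h0
  · rw [← h0]
    positivity
  · exact le_of_mul_le_mul_left h h0

variable {A : E →L[ℂ] E} {G : E →L⋆[ℂ] E →L[ℂ] CircleL1}

theorem operatorOfDensity_one
    (hA : ∀ (x y : E) (k : ℕ), fourierIntegral (k : ℤ) (G y x) = ⟪y, (A ^ k) x⟫_ℂ) :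
    operatorOfDensity G 1 = 1 := by
  ext x
  refine ext_inner_left ℂ fun y => ?_
  rw [inner_operatorOfDensity, pairing_one]
  simpa using hA x y 0

/-- Moving `A ^ k` onto `y` as an adjoint shifts the nonnegative frequencies of the density by `k`,
which is the effect of multiplying `f` by `z ^ k`. -/
theorem operatorOfDensity_coord_pow_mul
    (hA : ∀ (x y : E) (k : ℕ), fourierIntegral (k : ℤ) (G y x) = ⟪y, (A ^ k) x⟫_ℂ)
    (k : ℕ) (f : HInfty) :
    operatorOfDensity G (coord ^ k * f) = A ^ k * operatorOfDensity G f := by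
  ext x
  refine ext_inner_left ℂ fun y => ?_
  rw [inner_operatorOfDensity, _root_.mul_apply_eq_comp,
    ← ContinuousLinearMap.adjoint_inner_left, inner_operatorOfDensity]
  refine pairing_coord_pow_mul f k _ _ fun j => ?_
  rw [hA, hA, ContinuousLinearMap.adjoint_inner_left, add_comm, pow_add,
    _root_.mul_apply_eq_comp]

/-- Matrix coefficients of both sides are limits, as `r → 1`, of the same series `∑ aₖ rᵏ ⟨y, Aᵏ
h(A) x⟩`. -/
theorem operatorOfDensity_mul
    (hA : ∀ (x y : E) (k : ℕ), fourierIntegral (k : ℤ) (G y x) = ⟪y, (A ^ k) x⟫_ℂ)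
    (f h : HInfty) :
    operatorOfDensity G (f * h) = operatorOfDensity G f * operatorOfDensity G h := by
  ext x
  refine ext_inner_left ℂ fun y => ?_
  rw [_root_.mul_apply_eq_comp, inner_operatorOfDensity, inner_operatorOfDensity]
  have := neBot_radii
  refine tendsto_nhds_unique (tendsto_pairing_dilate_mul f h (G y x))
    (((tendsto_pairing f (G y (operatorOfDensity G h x))).comp Filter.tendsto_comap).congr
      fun r => ?_)
  refine (hasSum_radialIntegral f _ r.2).unique ?_
  -- The dilation is a norm-convergent power series, so the rule for powers of the coordinate
  -- function applies term by term.
  have H := (hasSum_dilate f r).map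
    ((pairingCLM.flip (G y x)).comp (ContinuousLinearMap.mul ℂ HInfty |>.flip h))
    (ContinuousLinearMap.continuous _)
  refine H.congr_fun fun k => ?_
  simp only [Function.comp_apply, map_smul, smul_eq_mul]
  congr 1
  rw [hA, ← _root_.mul_apply_eq_comp, ← operatorOfDensity_coord_pow_mul hA,
    inner_operatorOfDensity]
  rfl

/-- A contractive family of `L¹` densities whose nonnegative frequencies are the matrix
coefficients of the powers of `A` yields an `H^∞` functional calculus for `A`. -/
theorem exists_isHInftyFunctionalCalculus_of_density
    (hG : ∀ x y, ‖G y x‖ ≤ ‖y‖ * ‖x‖)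
    (hA : ∀ (x y : E) (k : ℕ), fourierIntegral (k : ℤ) (G y x) = ⟪y, (A ^ k) x⟫_ℂ) :
    ∃ Φ : HInfty →ₐ[ℂ] (E →L[ℂ] E), IsHInftyFunctionalCalculus A Φ := by
  refine ⟨AlgHom.ofLinearMap
    { toFun := operatorOfDensity G
      map_add' := fun f h => ?_
      map_smul' := fun c f => ?_ } (operatorOfDensity_one hA) (operatorOfDensity_mul hA),
    ?_, norm_operatorOfDensity_le G hG, ?_⟩
  · ext x
    refine ext_inner_left ℂ fun y => ?_
    simp only [_root_.add_apply, inner_add_right, inner_operatorOfDensity,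
      ← pairingCLM_apply, map_add]
  · ext x
    refine ext_inner_left ℂ fun y => ?_
    simp only [_root_.smul_apply, inner_smul_right, inner_operatorOfDensity,
      ← pairingCLM_apply, map_smul, RingHom.id_apply, smul_eq_mul]
  · have h := operatorOfDensity_coord_pow_mul hA 1 1
    rw [operatorOfDensity_one hA, pow_one, mul_one, pow_one, mul_one] at h
    exact h
  · refine continuous_iInf_rng.mpr fun p => continuous_induced_rng.mpr ?_
    -- Since `‖y‖ ‖x‖ ≤ ‖x‖² + ‖y‖²`, the densities are absolutely summable. Their sum is a single
    -- `L¹` function, and pairing with it is the pullback of the given weak* functional.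
    have hx : Summable fun k => ‖G (p.2 k) (p.1 k)‖ := by
      have h1 := (lp.memℓp p.1).summable (by norm_num)
      have h2 := (lp.memℓp p.2).summable (by norm_num)
      refine Summable.of_nonneg_of_le (fun _ => norm_nonneg _) (fun k => ?_) (h1.add h2)
      refine (hG _ _).trans ?_
      simp only [ENNReal.toReal_ofNat, Real.rpow_ofNat]
      nlinarith [sq_nonneg (‖p.1 k‖ - ‖p.2 k‖), sq_nonneg (‖p.1 k‖), sq_nonneg ‖p.2 k‖]
    have e : ((fun A : E →L[ℂ] E => ∑' k, ⟪p.2 k, A (p.1 k)⟫_ℂ) ∘ operatorOfDensity G) =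
        fun f : HInfty => pairing f (∑' k, G (p.2 k) (p.1 k)) := by
      funext f
      simp only [Function.comp_apply, inner_operatorOfDensity, ← pairingCLM_apply]
      exact ((pairingCLM f).map_tsum hx.of_norm).symm
    change Continuous[weakStarTopology, _]
      ((fun A : E →L[ℂ] E => ∑' k, ⟪p.2 k, A (p.1 k)⟫_ℂ) ∘ operatorOfDensity G)
    rw [e]
    exact continuous_iInf_dom continuous_induced_dom

end FunctionalCalculus

/-! ### The pointwise inner product on vector-valued `L²`. -/

section Dilation
open HInfty CircleL1

variable (E : Type*) [NormedAddCommGroup E] [InnerProductSpace ℂ E]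

/-- The space `L²` of the circle with values in `E`. -/
abbrev CircleL2 : Type _ := MeasureTheory.Lp E 2 (AddCircle.haarAddCircle (T := (1 : ℝ)))

variable {E}

/-- Pointwise Cauchy–Schwarz followed by Hölder with exponents 2 and 2. -/
theorem norm_toL1_inner_le (F G : CircleL2 E) :
    ‖(MeasureTheory.L2.integrable_inner (𝕜 := ℂ) F G).toL1 _‖ ≤ ‖F‖ * ‖G‖ := by
  rw [MeasureTheory.Integrable.norm_toL1_eq_lintegral_enorm]
  have h := MeasureTheory.eLpNorm_le_eLpNorm_mul_eLpNorm'_of_norm (p := 2) (q := 2) (r := 1)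
    (MeasureTheory.Lp.aestronglyMeasurable F) (MeasureTheory.Lp.aestronglyMeasurable G)
    (fun a b => ⟪a, b⟫_ℂ) 1
    (Filter.Eventually.of_forall fun t => by
      rw [NNReal.coe_one, one_mul]
      exact norm_inner_le_norm _ _)
  rw [MeasureTheory.eLpNorm_one_eq_lintegral_enorm, ENNReal.coe_one, one_mul] at h
  refine (ENNReal.toReal_mono (ENNReal.mul_ne_top (MeasureTheory.Lp.eLpNorm_ne_top F)
    (MeasureTheory.Lp.eLpNorm_ne_top G)) h).trans_eq ?_
  rw [ENNReal.toReal_mul, MeasureTheory.Lp.norm_def, MeasureTheory.Lp.norm_def]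

/-- The pointwise inner product `t ↦ ⟨F t, G t⟩` of square-integrable functions. -/
noncomputable def pointwiseInner : CircleL2 E →L⋆[ℂ] CircleL2 E →L[ℂ] CircleL1 :=
  LinearMap.mkContinuous₂
    (LinearMap.mk₂'ₛₗ (starRingEnd ℂ) (RingHom.id ℂ)
      (fun F G => (MeasureTheory.L2.integrable_inner (𝕜 := ℂ) F G).toL1 _)
      (fun F F' G => by
        rw [← MeasureTheory.Integrable.toL1_add]
        refine (MeasureTheory.Integrable.toL1_eq_toL1_iff _ _ _ _).mpr ?_
        filter_upwards [MeasureTheory.Lp.coeFn_add F F'] with t ht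
        simp only [ht, Pi.add_apply, inner_add_left])
      (fun c F G => by
        rw [← MeasureTheory.Integrable.toL1_smul]
        refine (MeasureTheory.Integrable.toL1_eq_toL1_iff _ _ _ _).mpr ?_
        filter_upwards [MeasureTheory.Lp.coeFn_smul c F] with t ht
        simp only [ht, Pi.smul_apply, inner_smul_left, smul_eq_mul])
      (fun F G G' => by
        rw [← MeasureTheory.Integrable.toL1_add]
        refine (MeasureTheory.Integrable.toL1_eq_toL1_iff _ _ _ _).mpr ?_
        filter_upwards [MeasureTheory.Lp.coeFn_add G G'] with t ht
        simp only [ht, Pi.add_apply, inner_add_right])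
      (fun c F G => by
        rw [← MeasureTheory.Integrable.toL1_smul]
        refine (MeasureTheory.Integrable.toL1_eq_toL1_iff _ _ _ _).mpr ?_
        filter_upwards [MeasureTheory.Lp.coeFn_smul c G] with t ht
        simp only [ht, Pi.smul_apply, inner_smul_right, smul_eq_mul, RingHom.id_apply]))
    1 (fun F G => by
      rw [one_mul]
      exact norm_toL1_inner_le F G)

theorem coeFn_pointwiseInner (F G : CircleL2 E) :
    pointwiseInner F G =ᵐ[AddCircle.haarAddCircle] fun t => ⟪F t, G t⟫_ℂ :=
  MeasureTheory.Integrable.coeFn_toL1 (MeasureTheory.L2.integrable_inner (𝕜 := ℂ) F G)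

theorem norm_pointwiseInner_le (F G : CircleL2 E) : ‖pointwiseInner F G‖ ≤ ‖F‖ * ‖G‖ :=
  norm_toL1_inner_le F G

theorem fourierIntegral_zero_pointwiseInner (F G : CircleL2 E) :
    fourierIntegral 0 (pointwiseInner F G) = ⟪F, G⟫_ℂ := by
  rw [fourierIntegral_apply, MeasureTheory.L2.inner_def]
  refine MeasureTheory.integral_congr_ae ?_
  filter_upwards [coeFn_pointwiseInner F G] with t ht
  rw [ht, fourier_zero, one_mul]

/-- The function `t ↦ ζ ^ k a` of `L²`. -/
noncomputable def vectorFourierLM (k : ℤ) : E →ₗ[ℂ] CircleL2 E where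
  toFun a := ContinuousMap.toLp 2 AddCircle.haarAddCircle ℂ
    (⟨fun t => fourier k t • a, by fun_prop⟩ : C(AddCircle (1 : ℝ), E))
  map_add' a b := by
    rw [← map_add]
    congr 1
    ext t
    exact smul_add _ _ _
  map_smul' c a := by
    rw [RingHom.id_apply, ← map_smul]
    congr 1
    ext t
    exact smul_comm _ _ _

theorem coeFn_vectorFourierLM (k : ℤ) (a : E) :
    vectorFourierLM k a =ᵐ[AddCircle.haarAddCircle (T := (1 : ℝ))]
      fun t => (fourier k t : ℂ) • a :=
  ContinuousMap.coeFn_toLp _ _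

/-- The first slot is conjugate-linear, so the characters multiply to frequency `j + l - k`, whose
mean vanishes unless it is `0`. -/
theorem fourierIntegral_pointwiseInner_vectorFourierLM (j k l : ℤ) (a b : E) :
    fourierIntegral j (pointwiseInner (vectorFourierLM k a) (vectorFourierLM l b)) =
      if j + l = k then ⟪a, b⟫_ℂ else 0 := by
  have h := integral_fourier (j + l - k)
  have e : fourierIntegral j (pointwiseInner (vectorFourierLM k a) (vectorFourierLM l b)) =
      (∫ t : AddCircle (1 : ℝ), fourier (j + l - k) t ∂AddCircle.haarAddCircle) * ⟪a, b⟫_ℂ := by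
    rw [fourierIntegral_apply, ← MeasureTheory.integral_mul_const]
    refine MeasureTheory.integral_congr_ae ?_
    filter_upwards [coeFn_pointwiseInner (vectorFourierLM k a) (vectorFourierLM l b),
      coeFn_vectorFourierLM k a, coeFn_vectorFourierLM l b] with t h1 h2 h3
    rw [h1, h2, h3, inner_smul_left, inner_smul_right, sub_eq_add_neg, fourier_add, fourier_add,
      fourier_neg]
    ring
  rw [e, h]
  simp only [sub_eq_zero, ite_mul, one_mul, zero_mul]

/-- The isometry `a ↦ ζ ^ k a` from `E` to `L²`. -/
noncomputable def vectorFourier (k : ℤ) : E →ₗᵢ[ℂ] CircleL2 E :=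
  (vectorFourierLM k).isometryOfInner fun a b => by
    rw [← fourierIntegral_zero_pointwiseInner, fourierIntegral_pointwiseInner_vectorFourierLM,
      if_pos (zero_add k)]

theorem orthogonalFamily_vectorFourier :
    OrthogonalFamily ℂ (fun _ : ℕ => E) (fun k : ℕ => vectorFourier (E := E) (k : ℤ)) := by
  intro k l hkl a b
  change ⟪vectorFourierLM (k : ℤ) a, vectorFourierLM (l : ℤ) b⟫_ℂ = 0
  rw [← fourierIntegral_zero_pointwiseInner, fourierIntegral_pointwiseInner_vectorFourierLM,
    if_neg (by omega)]

variable [CompleteSpace E]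

/-- The isometry that maps a square-summable sequence `a` to `∑ ζ ^ k aₖ`. -/
noncomputable def vectorFourierSeries : lp (fun _ : ℕ => E) 2 →ₗᵢ[ℂ] CircleL2 E :=
  (orthogonalFamily_vectorFourier (E := E)).linearIsometry

theorem hasSum_vectorFourierSeries (a : lp (fun _ : ℕ => E) 2) :
    HasSum (fun k : ℕ => vectorFourierLM (k : ℤ) (a k)) (vectorFourierSeries a) :=
  (orthogonalFamily_vectorFourier (E := E)).hasSum_linearIsometry a

/-- Expanding `b` and then `a`, each by continuity in one slot, leaves only the terms `k = j + l`.
Frequency `j` thus pairs `b` with `a` shifted back by `j` places. -/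
theorem hasSum_fourierIntegral_pointwiseInner (j : ℕ) (a b : lp (fun _ : ℕ => E) 2) :
    HasSum (fun l : ℕ => ⟪a (j + l), b l⟫_ℂ)
      (fourierIntegral (j : ℤ) (pointwiseInner (vectorFourierSeries a) (vectorFourierSeries b))) := by
  have h1 := (hasSum_vectorFourierSeries b).map
    ((fourierIntegral (j : ℤ)).comp (pointwiseInner (vectorFourierSeries a)))
    (ContinuousLinearMap.continuous _)
  refine h1.congr_fun fun l => ?_
  have h2 := (hasSum_vectorFourierSeries a).map
    ((fourierIntegral (j : ℤ)).comp (pointwiseInner.flip (vectorFourierLM (l : ℤ) (b l))))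
    (ContinuousLinearMap.continuous _)
  refine HasSum.unique ?_ h2
  have h3 : ∀ k : ℕ, fourierIntegral (j : ℤ)
      (pointwiseInner (vectorFourierLM (k : ℤ) (a k)) (vectorFourierLM (l : ℤ) (b l))) =
        if k = j + l then ⟪a k, b l⟫_ℂ else 0 := fun k => by
    rw [fourierIntegral_pointwiseInner_vectorFourierLM]
    exact if_congr (by omega) rfl rfl
  have h4 : HasSum (fun k : ℕ => if k = j + l then ⟪a k, b l⟫_ℂ else 0) ⟪a (j + l), b l⟫_ℂ := by
    convert hasSum_single (j + l) fun k hk => if_neg hk using 1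
    rw [if_pos rfl]
  exact h4.congr_fun h3

/-! ### The backward-shift model of a stable contraction. -/

-- `D` is the defect operator, the positive square root of `1 - T*T`, which is positive because `T`
-- is a contraction.
open ContinuousLinearMap in
theorem exists_defect (T : E →L[ℂ] E) (hT : ‖T‖ ≤ 1) :
    ∃ D : E →L[ℂ] E, ∀ x y, ⟪D x, D y⟫_ℂ = ⟪x, y⟫_ℂ - ⟪T x, T y⟫_ℂ := by
  have hpos : (0 : E →L[ℂ] E) ≤ 1 - adjoint T * T := by
    rw [nonneg_iff_isPositive, isPositive_def']
    refine ⟨?_, fun x => ?_⟩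
    · exact (IsSelfAdjoint.one _).sub (IsSelfAdjoint.star_mul_self T)
    · rw [reApplyInnerSelf_apply, sub_apply, inner_sub_left, map_sub, one_apply_eq_self,
        mul_apply_eq_comp, adjoint_inner_left, inner_self_eq_norm_sq, inner_self_eq_norm_sq,
        sub_nonneg]
      have := (T.le_of_opNorm_le hT x)
      rw [one_mul] at this
      gcongr
  refine ⟨CFC.sqrt (1 - adjoint T * T), fun x y => ?_⟩
  have hsa : adjoint (CFC.sqrt (1 - adjoint T * T)) = CFC.sqrt (1 - adjoint T * T) :=
    (IsSelfAdjoint.of_nonneg (CFC.sqrt_nonneg _)).star_eq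
  rw [← adjoint_inner_right, hsa, ← mul_apply_eq_comp, CFC.sqrt_mul_sqrt_self _ hpos, sub_apply,
    inner_sub_right, one_apply_eq_self, mul_apply_eq_comp, adjoint_inner_right]

/-- A contraction whose powers tend to `0` strongly is a part of a backward shift: there is an
isometry `W` to square-summable sequences that turns the powers of `T` into shifts. -/
theorem exists_isometry_backwardShift (T : E →L[ℂ] E) (hT : ‖T‖ ≤ 1)
    (h0 : ∀ x, Filter.Tendsto (fun k : ℕ => (T ^ k) x) Filter.atTop (𝓝 0)) :
    ∃ W : E →ₗᵢ[ℂ] lp (fun _ : ℕ => E) 2, ∀ x (j k : ℕ), W ((T ^ j) x) k = W x (j + k) := by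
  obtain ⟨D, hD⟩ := exists_defect T hT
  -- The squared norms telescope to `‖x‖² - ‖Tⁿ x‖²`; strong stability removes the last term and
  -- makes `W` isometric.
  have hterm : ∀ x k, ‖D ((T ^ k) x)‖ ^ 2 = ‖(T ^ k) x‖ ^ 2 - ‖(T ^ (k + 1)) x‖ ^ 2 := by
    intro x k
    have h := congrArg RCLike.re (hD ((T ^ k) x) ((T ^ k) x))
    rw [map_sub, inner_self_eq_norm_sq, inner_self_eq_norm_sq, inner_self_eq_norm_sq] at h
    rw [h, pow_succ' T k, mul_apply_eq_comp]
  have hsum : ∀ x, HasSum (fun k => ‖D ((T ^ k) x)‖ ^ 2) (‖x‖ ^ 2) := by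
    intro x
    rw [hasSum_iff_tendsto_nat_of_nonneg (fun k => by positivity)]
    have e : ∀ n, ∑ k ∈ Finset.range n, ‖D ((T ^ k) x)‖ ^ 2 = ‖x‖ ^ 2 - ‖(T ^ n) x‖ ^ 2 := by
      intro n
      simp only [hterm]
      rw [Finset.sum_range_sub']
      simp
    simp only [e]
    simpa using ((h0 x).norm.pow 2).const_sub (‖x‖ ^ 2)
  have hmem : ∀ x, Memℓp (fun k : ℕ => D ((T ^ k) x)) 2 := fun x =>
    (memℓp_gen_iff (by norm_num)).mpr (by simpa using (hsum x).summable)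
  refine ⟨{ toFun := fun x => ⟨fun k : ℕ => D ((T ^ k) x), hmem x⟩
            map_add' := fun x y => by
              ext k
              change D ((T ^ k) (x + y)) = D ((T ^ k) x) + D ((T ^ k) y)
              rw [map_add, map_add]
            map_smul' := fun c x => by
              ext k
              change D ((T ^ k) (c • x)) = c • D ((T ^ k) x)
              rw [map_smul, map_smul]
            norm_map' := fun x => ?_ }, fun x j k => ?_⟩
  · have h := lp.norm_rpow_eq_tsum (p := 2) (by norm_num)
      (⟨fun k : ℕ => D ((T ^ k) x), hmem x⟩ : lp (fun _ : ℕ => E) 2)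
    simp only [ENNReal.toReal_ofNat, Real.rpow_ofNat] at h
    rw [(hsum x).tsum_eq] at h
    exact (sq_eq_sq₀ (norm_nonneg _) (norm_nonneg _)).mp h
  · change D ((T ^ k) ((T ^ j) x)) = D ((T ^ (j + k)) x)
    rw [add_comm, pow_add, mul_apply_eq_comp]

/-- A contraction with adjoint powers tending strongly to `0` has an `H^∞` functional calculus. -/
theorem exists_isHInftyFunctionalCalculus (A : E →L[ℂ] E) (hA : ‖A‖ ≤ 1)
    (h0 : ∀ x, Filter.Tendsto (fun k : ℕ => (ContinuousLinearMap.adjoint A ^ k) x)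
      Filter.atTop (𝓝 0)) :
    ∃ Φ : HInfty →ₐ[ℂ] (E →L[ℂ] E), IsHInftyFunctionalCalculus A Φ := by
  obtain ⟨W, hW⟩ := exists_isometry_backwardShift (ContinuousLinearMap.adjoint A)
    (by rwa [LinearIsometryEquiv.norm_map]) h0
  set J : E →ₗᵢ[ℂ] CircleL2 E := vectorFourierSeries.comp W with hJ
  refine exists_isHInftyFunctionalCalculus_of_density (A := A)
    (G := (LinearMap.mk₂'ₛₗ (starRingEnd ℂ) (RingHom.id ℂ) (fun y x => pointwiseInner (J y) (J x))
      (by simp) (by simp) (by simp) (by simp)).mkContinuous₂ 1 fun y x => ?_)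
    (fun x y => ?_) (fun x y k => ?_)
  · simpa using norm_pointwiseInner_le (J y) (J x)
  · simpa using norm_pointwiseInner_le (J y) (J x)
  · refine (hasSum_fourierIntegral_pointwiseInner k (W y) (W x)).unique ?_
    -- `W` turns powers of the adjoint into backward shifts, so this inner product becomes the
    -- correlation sum computed above.
    have e : ⟪y, (A ^ k) x⟫_ℂ = ⟪W ((ContinuousLinearMap.adjoint A ^ k) y), W x⟫_ℂ := by
      rw [LinearIsometry.inner_map_map, ← ContinuousLinearMap.adjoint_inner_left]
      congr 2
      exact star_pow A k
    rw [e]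
    refine (lp.hasSum_inner _ _).congr_fun fun l => ?_
    rw [hW]

end Dilation

/-! ### Vectors on which the powers of a contraction tend to `0`. -/

section StrongStability

variable {E : Type*} [NormedAddCommGroup E] [NormedSpace ℂ E]

/-- The vectors on which the powers of a contraction tend to `0`. -/
def stableSubmodule (T : E →L[ℂ] E) : Submodule ℂ E where
  carrier := {x | Filter.Tendsto (fun k : ℕ => (T ^ k) x) Filter.atTop (𝓝 0)}
  add_mem' {x y} hx hy := by
    simpa only [Set.mem_ofPred_eq, map_add, add_zero] using Filter.Tendsto.add hx hy
  zero_mem' := by simp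
  smul_mem' c x hx := by
    simpa only [Set.mem_ofPred_eq, map_smul, smul_zero] using Filter.Tendsto.const_smul hx c

theorem mem_stableSubmodule {T : E →L[ℂ] E} {x : E} : x ∈ stableSubmodule T ↔
    Filter.Tendsto (fun k : ℕ => (T ^ k) x) Filter.atTop (𝓝 0) := Iff.rfl

theorem norm_pow_apply_le {T : E →L[ℂ] E} (hT : ‖T‖ ≤ 1) (k : ℕ) (x : E) :
    ‖(T ^ k) x‖ ≤ ‖x‖ := by
  induction k with
  | zero => simp
  | succ k ih =>
    rw [pow_succ', mul_apply_eq_comp]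
    have h := T.le_of_opNorm_le hT ((T ^ k) x)
    rw [one_mul] at h
    exact h.trans ih

/-- The powers are uniformly bounded by one, so a stable vector near `x` controls the whole tail of
the orbit of `x`. -/
theorem isClosed_stableSubmodule {T : E →L[ℂ] E} (hT : ‖T‖ ≤ 1) :
    IsClosed (stableSubmodule T : Set E) := by
  refine isClosed_of_closure_subset fun x hx => ?_
  refine Metric.tendsto_atTop.mpr fun ε hε => ?_
  obtain ⟨y, hy, hxy⟩ := Metric.mem_closure_iff.mp hx (ε / 2) (by positivity)
  obtain ⟨N, hN⟩ := Metric.tendsto_atTop.mp (mem_stableSubmodule.mp hy) (ε / 2) (by positivity)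
  refine ⟨N, fun k hk => ?_⟩
  have h1 := hN k hk
  have h2 := norm_pow_apply_le hT k (x - y)
  rw [dist_zero_right] at h1 ⊢
  rw [dist_eq_norm] at hxy
  have h3 := norm_add_le ((T ^ k) (x - y)) ((T ^ k) y)
  rw [← map_add, sub_add_cancel] at h3
  linarith

/-- Eigenvectors modulo stable vectors are stable if the eigenvalue has modulus less than one. -/
theorem mem_stableSubmodule_of_sub_smul {T : E →L[ℂ] E} (hT : ‖T‖ ≤ 1) {c : ℂ} (hc : ‖c‖ < 1)
    {x : E} (hx : T x - c • x ∈ stableSubmodule T) : x ∈ stableSubmodule T := by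
  have hanti : Antitone fun k : ℕ => ‖(T ^ k) x‖ := by
    refine antitone_nat_of_succ_le fun k => ?_
    rw [pow_succ', mul_apply_eq_comp]
    simpa using T.le_of_opNorm_le hT ((T ^ k) x)
  have hlim := tendsto_atTop_ciInf hanti ⟨0, by rintro _ ⟨k, rfl⟩; exact norm_nonneg _⟩
  set l := ⨅ k : ℕ, ‖(T ^ k) x‖
  have hl : 0 ≤ l := ge_of_tendsto' hlim fun k => norm_nonneg _
  -- The norms along the orbit decrease to `l`. Passing to the limit in `Tᵏ⁺¹ x = c Tᵏ x + Tᵏ (T x -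
  -- c x)` gives this bound, and `‖c‖ < 1` forces `l = 0`.
  have hle : l ≤ ‖c‖ * l + 0 := by
    have h0 := (mem_stableSubmodule.mp hx).norm
    rw [norm_zero] at h0
    refine le_of_tendsto_of_tendsto' (hlim.comp (Filter.tendsto_add_atTop_nat 1))
      ((hlim.const_mul ‖c‖).add h0) fun k => ?_
    have e : (T ^ (k + 1)) x = c • (T ^ k) x + (T ^ k) (T x - c • x) := by
      rw [map_sub, map_smul, pow_succ, mul_apply_eq_comp, add_sub_cancel]
    rw [Function.comp_apply, e, ← norm_smul]
    exact norm_add_le _ _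
  have hl0 : l = 0 := by nlinarith
  rw [hl0] at hlim
  exact tendsto_zero_iff_norm_tendsto_zero.mpr hlim

end StrongStability

/-! ### Triangularity and stability in the free semigroup algebra. -/

namespace FockSpace

variable {ι : Type*}

theorem inner_xi_left (w : FreeMonoid ι) (x : FockSpace ι) : ⟪xi w, x⟫_ℂ = x w := by
  classical
  rw [xi, lp.inner_single_left]
  simp

theorem inner_xi_xi (v w : FreeMonoid ι) [Decidable (v = w)] :
    ⟪(xi v : FockSpace ι), xi w⟫_ℂ = if v = w then 1 else 0 := by
  split_ifs with h
  · rw [h, inner_self_eq_norm_sq_to_K, (orthonormal_xi ι).1 w]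
    simp
  · exact (orthonormal_xi ι).2 h

theorem hasSum_xi (x : FockSpace ι) : HasSum (fun w => x w • (xi w : FockSpace ι)) x := by
  classical
  refine (lp.hasSum_single ENNReal.ofNat_ne_top x).congr_fun fun w => ?_
  rw [xi, ← lp.single_smul, smul_eq_mul, mul_one]

theorem ext_xi {F : Type*} [NormedAddCommGroup F] [NormedSpace ℂ F] {A B : FockSpace ι →L[ℂ] F}
    (h : ∀ w, A (xi w) = B (xi w)) : A = B := by
  ext1 x
  refine ((hasSum_xi x).map A A.continuous).unique
    (((hasSum_xi x).map B B.continuous).congr_fun fun w => ?_)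
  rw [Function.comp_apply, Function.comp_apply, map_smul, map_smul, h]

/-- The right regular representation: `R_u` maps `ξ_v` to `ξ_{vu}`. -/
noncomputable def rightShift (u : FreeMonoid ι) : FockSpace ι →L[ℂ] FockSpace ι :=
  ((orthonormal_xi ι).comp (fun v => v * u)
    (fun _ _ h => mul_right_cancel h)).orthogonalFamily.linearIsometry.toContinuousLinearMap

theorem rightShift_xi (u v : FreeMonoid ι) :
    rightShift u (xi v : FockSpace ι) = xi (v * u) := by
  classical
  have h := ((orthonormal_xi ι).comp (fun v => v * u)
    (fun _ _ h => mul_right_cancel h)).orthogonalFamily.linearIsometry_apply_single (i := v) (1 : ℂ)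
  rw [LinearIsometry.toSpanSingleton_apply, one_smul] at h
  exact h

/-- Right shifts commute with the generators by associativity of words, and the closed algebra
generated lies in the double centralizer. -/
theorem commute_rightShift {L : FockSpace ι →L[ℂ] FockSpace ι}
    (hL : L ∈ analyticToeplitzAlgebra ι) (u : FreeMonoid ι) : rightShift u * L = L * rightShift u := by
  have h := Subalgebra.topologicalClosure_adjoin_le_centralizer_centralizer ℂ _ hL
  have h' := Subalgebra.mem_centralizer_iff ℂ |>.mp h
    (ContinuousLinearMapWOT.ofCLM (rightShift u)) (by
      rw [SetLike.mem_coe, Subalgebra.mem_centralizer_iff]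
      rintro _ ⟨i, rfl⟩
      rw [← ContinuousLinearMapWOT.ofCLM_mul, ← ContinuousLinearMapWOT.ofCLM_mul]
      congr 1
      refine ext_xi fun w => ?_
      rw [mul_apply_eq_comp, mul_apply_eq_comp, rightShift_xi, leftShift_xi, leftShift_xi,
        rightShift_xi, mul_assoc])
  exact congrArg ContinuousLinearMapWOT.toCLM h'

theorem apply_xi_eq_rightShift {L : FockSpace ι →L[ℂ] FockSpace ι}
    (hL : L ∈ analyticToeplitzAlgebra ι) (u : FreeMonoid ι) :
    L (xi u) = rightShift u (L (xi 1)) := by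
  rw [← mul_apply_eq_comp, commute_rightShift hL, mul_apply_eq_comp, rightShift_xi, one_mul]

/-- A word `v * u` of length at most that of `u` must have `v = 1`. -/
theorem rightShift_apply_of_length_le (u w : FreeMonoid ι) [Decidable (u = w)]
    (h : w.length ≤ u.length) (x : FockSpace ι) :
    rightShift u x w = if u = w then x 1 else 0 := by
  have e : (innerSL ℂ (xi w : FockSpace ι)).comp (rightShift u) =
      if u = w then innerSL ℂ (xi 1 : FockSpace ι) else 0 := by
    classical
    refine ext_xi fun v => ?_
    rw [ContinuousLinearMap.comp_apply, rightShift_xi, innerSL_apply_apply, inner_xi_xi]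
    have hv : w = v * u ↔ u = w ∧ 1 = v := by
      constructor
      · intro hw
        have hlen := congrArg FreeMonoid.length hw
        rw [FreeMonoid.length_mul] at hlen
        have hv1 : v = 1 := FreeMonoid.length_eq_zero.mp (by omega)
        rw [hv1, one_mul] at hw
        exact ⟨hw.symm, hv1.symm⟩
      · rintro ⟨rfl, rfl⟩
        rw [one_mul]
    split_ifs with h1 h2 h2
    · rw [innerSL_apply_apply, inner_xi_xi, if_pos (hv.mp h1).2]
    · exact absurd (hv.mp h1).1 h2
    · rw [innerSL_apply_apply, inner_xi_xi, if_neg fun h3 => h1 (hv.mpr ⟨h2, h3⟩)]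
    · rfl
  have h2 := congrArg (fun A : FockSpace ι →L[ℂ] ℂ => A x) e
  simp only [ContinuousLinearMap.comp_apply, innerSL_apply_apply, inner_xi_left] at h2
  rw [h2]
  split_ifs
  · rw [innerSL_apply_apply, inner_xi_left]
  · rfl

/-- This is the triangularity: the adjoint sends `ξ_w` to a constant multiple of itself plus a
combination of strictly shorter words, with the same constant for every `w`. -/
theorem adjoint_apply_xi_apply {L : FockSpace ι →L[ℂ] FockSpace ι}
    (hL : L ∈ analyticToeplitzAlgebra ι) (u w : FreeMonoid ι) [Decidable (u = w)]
    (h : w.length ≤ u.length) :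
    ContinuousLinearMap.adjoint L (xi w) u =
      if u = w then starRingEnd ℂ (L (xi 1 : FockSpace ι) 1) else 0 := by
  rw [← inner_xi_left, ContinuousLinearMap.adjoint_inner_right, ← inner_conj_symm, inner_xi_left,
    apply_xi_eq_rightShift hL, rightShift_apply_of_length_le u w h]
  split_ifs
  · rfl
  · exact map_zero _

theorem norm_xi (w : FreeMonoid ι) : ‖(xi w : FockSpace ι)‖ = 1 := (orthonormal_xi ι).1 w

/-- A contraction in the algebra whose diagonal entry has modulus one is unitary. -/
theorem mem_unitary_of_norm_eq_one {L : FockSpace ι →L[ℂ] FockSpace ι}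
    (hL : L ∈ analyticToeplitzAlgebra ι) (hcontr : ‖L‖ ≤ 1)
    (h : ‖L (xi 1 : FockSpace ι) 1‖ = 1) : L ∈ unitary (FockSpace ι →L[ℂ] FockSpace ι) := by
  set c : ℂ := L (xi 1 : FockSpace ι) 1 with hc
  -- Equality case of Cauchy–Schwarz: `‖L ξ₁ - c ξ₁‖² = ‖L ξ₁‖² - 2 + 1 ≤ 0`.
  have h1 : L (xi 1) = c • (xi 1 : FockSpace ι) := by
    have hle : ‖L (xi 1 : FockSpace ι)‖ ≤ 1 := by
      simpa [norm_xi] using L.le_of_opNorm_le hcontr (xi 1 : FockSpace ι)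
    have hin : ⟪L (xi 1 : FockSpace ι), c • (xi 1 : FockSpace ι)⟫_ℂ = 1 := by
      rw [inner_smul_right, ← inner_conj_symm, inner_xi_left, ← hc, Complex.mul_conj']
      simp [h]
    have hsq := norm_sub_sq (𝕜 := ℂ) (L (xi 1 : FockSpace ι)) (c • (xi 1 : FockSpace ι))
    rw [hin, norm_smul, norm_xi, h] at hsq
    simp only [RCLike.one_re, mul_one, one_pow] at hsq
    have h0 : ‖L (xi 1 : FockSpace ι) - c • (xi 1 : FockSpace ι)‖ = 0 := by
      nlinarith [norm_nonneg (L (xi 1 : FockSpace ι)),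
        norm_nonneg (L (xi 1 : FockSpace ι) - c • (xi 1 : FockSpace ι))]
    exact sub_eq_zero.mp (norm_eq_zero.mp h0)
  -- Right shifts carry the vacuum eigenvector equation to every basis vector.
  have h2 : L = c • 1 := by
    refine ext_xi fun u => ?_
    rw [apply_xi_eq_rightShift hL, h1, map_smul, rightShift_xi, one_mul]
    rfl
  have h3 : c * starRingEnd ℂ c = 1 := by
    rw [Complex.mul_conj']
    simp [h]
  rw [Unitary.mem_iff, h2]
  constructor
  · rw [star_smul, star_one, smul_mul_smul_comm, mul_one, mul_comm]
    exact (congrArg (· • _) h3).trans (one_smul _ _)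
  · rw [star_smul, star_one, smul_mul_smul_comm, mul_one]
    exact (congrArg (· • _) h3).trans (one_smul _ _)

/-- The powers of the adjoint of a non-unitary contraction in the algebra tend strongly to `0`. -/
theorem tendsto_adjoint_pow {L : FockSpace ι →L[ℂ] FockSpace ι}
    (hL : L ∈ analyticToeplitzAlgebra ι) (hcontr : ‖L‖ ≤ 1)
    (hunit : L ∉ unitary (FockSpace ι →L[ℂ] FockSpace ι)) (x : FockSpace ι) :
    Filter.Tendsto (fun k : ℕ => (ContinuousLinearMap.adjoint L ^ k) x) Filter.atTop (𝓝 0) := by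
  classical
  set T := ContinuousLinearMap.adjoint L with hTdef
  have hT : ‖T‖ ≤ 1 := by rwa [hTdef, LinearIsometryEquiv.norm_map]
  have hc : ‖starRingEnd ℂ (L (xi 1 : FockSpace ι) 1)‖ < 1 := by
    rw [RCLike.norm_conj]
    refine lt_of_le_of_ne ?_ fun h => hunit (mem_unitary_of_norm_eq_one hL hcontr h)
    rw [← inner_xi_left]
    refine (norm_inner_le_norm _ _).trans ?_
    rw [norm_xi, one_mul]
    simpa [norm_xi] using L.le_of_opNorm_le hcontr (xi 1 : FockSpace ι)
  -- The remainder in the triangular form may be an infinite combination of shorter words, so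
  -- closedness of the stable subspace is needed.
  have hmem : ∀ (y : FockSpace ι), (∀ w, y w ≠ 0 → (xi w : FockSpace ι) ∈ stableSubmodule T) →
      y ∈ stableSubmodule T := by
    intro y hy
    refine (isClosed_stableSubmodule hT).mem_of_tendsto (hasSum_xi y)
      (Filter.Eventually.of_forall fun s => Submodule.sum_mem _ fun w _ => ?_)
    by_cases hw : y w = 0
    · rw [hw, zero_smul]
      exact Submodule.zero_mem _
    · exact Submodule.smul_mem _ _ (hy w hw)
  have hxi : ∀ (n : ℕ) (w : FreeMonoid ι), w.length = n → (xi w : FockSpace ι) ∈ stableSubmodule T := by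
    intro n
    -- No separate base case: for the empty word there are no shorter words, and the remainder
    -- vanishes.
    induction n using Nat.strong_induction_on with
    | _ n ih =>
      intro w hw
      refine mem_stableSubmodule_of_sub_smul hT hc (hmem _ fun u hu => ?_)
      by_cases hlt : u.length < w.length
      · exact ih _ (hw ▸ hlt) u rfl
      · refine absurd ?_ hu
        rw [lp.coeFn_sub, Pi.sub_apply, lp.coeFn_smul, Pi.smul_apply,
          adjoint_apply_xi_apply hL u w (not_lt.mp hlt), ← inner_xi_left u (xi w), inner_xi_xi]
        split_ifs <;> simp
  exact hmem x fun w _ => hxi _ w rfl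

end FockSpace

theorem corollary1p6 (ι : Type*) [Countable ι] [Nonempty ι]
    (L : FockSpace ι →L[ℂ] FockSpace ι) (hL : L ∈ FockSpace.analyticToeplitzAlgebra ι)
    (hcontr : ‖L‖ ≤ 1) (hunit : L ∉ unitary (FockSpace ι →L[ℂ] FockSpace ι)) :
    ∃ Φ : HInfty →ₐ[ℂ] (FockSpace ι →L[ℂ] FockSpace ι), IsHInftyFunctionalCalculus L Φ :=
  exists_isHInftyFunctionalCalculus L hcontr (FockSpace.tendsto_adjoint_pow hL hcontr hunit)
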